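/- Consider the hyperbolic plane in Poincaré's disc model $\{z\in\mathbb C:|z|<1\}$; its ends (points at infinity) are the points of the unit circle. The pentagrid is the tessellation $\{5,4\}$, generated from a regular right-angled pentagon by reflections in its sides and, recursively, in the sides of its images. A line of the pentagrid is a line supporting an edge of a tile. A quarter with head $P$ (a tile) and vertex $S$ (a vertex of $P$) is the intersection of the two closed half-planes which contain $P$ and whose lines support the two edges of $P$ meeting at $S$. A tile is encoded by the finite word of sides, numbered $0,\dots,4$ in the base tile and transported by the reflections, that are crossed on a path from the base tile to it; a line of the pentagrid, or a quarter, is encoded by a tile and the number of one of its sides, or vertices. A quarter $F$ is embedded in $F'$ if $F\subseteq F'$, strictly embedded if $F$ lies in the interior of $F'$, and embedded in one step if moreover the heads of $F$ and $F'$ are distinct and share an edge. A sequence $(F_k)_{k\in\mathbb N}$ of quarters is stepwise if each $F_k$ is embedded in one step in $F_{k+1}$; it has no alternation if there is no $k$ such that neither $F_k\subseteq F_{k+1}$ nor $F_{k+1}\subseteq F_{k+2}$ is a strict embedding while $F_k$ is strictly embedded in $F_{k+2}$. Say that a sequence of quarters defines the end $\alpha$ if it is stepwise, has no alternation, and its vertices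 converge to $\alpha$. Say that a sequence $(\lambda_k)_{k\in\mathbb N}$ of lines of the pentagrid defines the end $\alpha$ if no $\lambda_k$ passes through $\alpha$ and the half-planes $\pi_k$ delimited by $\lambda_k$ which touch $\alpha$ satisfy $\pi_{k+1}\subseteq\pi_k$ and form a basis of neighbourhoods of $\alpha$, that is, every half-plane which touches $\alpha$ and whose border does not pass through $\alpha$ contains some $\pi_k$. Theorem. (1) There is no algorithm which, given any two programs that compute sequences of lines of the pentagrid defining ends $\alpha$ and $\beta$, halts and tells whether $\alpha=\beta$. (Nothing is required of the algorithm on other inputs.) (2) There is no algorithm which, given any two programs that compute sequences of quarters defining ends $\alpha$ and $\beta$, halts and tells whether $\alpha=\beta$. (3) There are quarters $F_{n,k}$ and lines of the pentagrid $\lambda_{n,k}$, both computable from $(n,k)\in\mathbb N^2$, and an end $\alpha_0$ such that for each $n$ the sequences $(F_{n,k})_{k\in\mathbb N}$ and $(\lambda_{n,k})_{k\in\mathbb N}$ define the same end, which is $\alpha_0$ if the $n$-th machine does not halt on the input $n$, and is an end different from $\alpha_0$ (which may depend on $n$) if it does. -/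

import Mathlib

/-! ### The hyperbolic plane

The hyperbolic plane is the open unit disc of `ℂ` (the model of Poincaré); its ends, or points at
infinity, are the points of the unit circle. -/

namespace Pentagrid

noncomputable section

/-- The function `a (1 + |z|²) - 2 Re (b̄ z)`. For `|a| < |b|`, its zero set is the circle
orthogonal to the unit circle with centre `b / a` (for `a = 0`: the straight line through `0`
orthogonal to `b`). -/
def form (a : ℝ) (b z : ℂ) : ℝ :=
  a * (1 + ‖z‖ ^ 2) - 2 * ((starRingEnd ℂ) b * z).re

/-- The hyperbolic line with parameters `a`, `b`, where `|a| < |b|`. The ends through which it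
passes are the two points of the unit circle at which `form a b` vanishes. -/
def line (a : ℝ) (b : ℂ) : Set ℂ := {z | ‖z‖ < 1 ∧ form a b z = 0}

/-- One of the two closed half-planes delimited by `line a b`, where `|a| < |b|`; the other one
is `halfPlane (-a) (-b)`. -/
def halfPlane (a : ℝ) (b : ℂ) : Set ℂ := {z | ‖z‖ < 1 ∧ 0 ≤ form a b z}

/-- `H` is a half-plane delimited by the hyperbolic line `l`. -/
def IsHalfPlaneOf (l H : Set ℂ) : Prop :=
  ∃ (a : ℝ) (b : ℂ), |a| < ‖b‖ ∧ l = line a b ∧ H = halfPlane a b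

/-- `H` is a half-plane, delimited by a line that does not pass through the end `α`, and `H`
touches `α`, that is, `α` is on the side of `H`. -/
def Touches (H : Set ℂ) (α : Circle) : Prop :=
  ∃ (a : ℝ) (b : ℂ), |a| < ‖b‖ ∧ H = halfPlane a b ∧ 0 < form a b (α : ℂ)

/-! ### The pentagrid

The base tile is the regular pentagon with right angles centred at `0`. Its sides are numbered
counter-clockwise by `Fin 5`. -/

/-- The (Euclidean) centre of the circle that supports side `i` of the base tile. Two consecutive
ones of these five circles are orthogonal, as `|centre|² cos (2π/5) = 1`, and all of them are
orthogonal to the unit circle: the square of their radius is `√5 = |centre|² - 1`. -/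
def sideCentre (i : Fin 5) : ℂ :=
  (Real.sqrt (1 + Real.sqrt 5) : ℂ) * Complex.exp ((2 * Real.pi * (i : ℕ) / 5 : ℝ) * Complex.I)

/-- The half-plane that contains the base tile and is delimited by the line of its side `i`. -/
def baseHalfPlane (i : Fin 5) : Set ℂ := halfPlane 1 (sideCentre i)

/-- The line that supports side `i` of the base tile. -/
def baseLine (i : Fin 5) : Set ℂ := line 1 (sideCentre i)

/-- The base tile. -/
def baseTile : Set ℂ := ⋂ i, baseHalfPlane i

/-- The vertex number `i` of the base tile: the common point of its sides `i` and `i + 1`. -/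
def baseVertex (i : Fin 5) : ℂ :=
  ((Real.sqrt (1 + Real.sqrt 5 / 2) - Real.sqrt (Real.sqrt 5 / 2) : ℝ) : ℂ) *
    Complex.exp ((Real.pi * (2 * (i : ℕ) + 1) / 5 : ℝ) * Complex.I)

/-- The hyperbolic reflection in side `i` of the base tile. -/
def reflection (i : Fin 5) (z : ℂ) : ℂ :=
  EuclideanGeometry.inversion (sideCentre i) (Real.sqrt (Real.sqrt 5)) z

/-- The isometry of the hyperbolic plane that takes the base tile to the tile with address `w`. -/
def motion : List (Fin 5) → ℂ → ℂ
  | [] => id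
  | i :: w => reflection i ∘ motion w

/-- The tile with address `w`. The tile with address `[]` is the base tile and the one with address
`w ++ [i]` is the image of the tile with address `w` by the reflection in its side `i` (the image
of side `i` of the base tile). The tiles obtained in this way are those of the pentagrid, the
tessellation {5,4}. -/
def tile (w : List (Fin 5)) : Set ℂ := motion w '' baseTile

/-- Side `i` of the tile with address `w`, a segment. -/
def edge (w : List (Fin 5)) (i : Fin 5) : Set ℂ := motion w '' (baseTile ∩ baseLine i)

/-- A finite code for a line of the pentagrid or for a quarter: the address of a tile and the number
of a side or of a vertex of that tile. -/
abbrev Address : Type := List (Fin 5) × Fin 5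

/-- The line of the pentagrid that supports side `p.2` of the tile with address `p.1`. -/
def gridLine (p : Address) : Set ℂ := motion p.1 '' baseLine p.2

/-- The vertex number `p.2` of the tile with address `p.1`. -/
def vertex (p : Address) : ℂ := motion p.1 (baseVertex p.2)

/-- The quarter whose head is the tile with address `p.1` and whose vertex is `vertex p`: the
intersection of the two half-planes that contain the head and whose lines support the two
sides of the head that meet at the vertex. -/
def quarter (p : Address) : Set ℂ :=
  motion p.1 '' (baseHalfPlane p.2 ∩ baseHalfPlane (p.2 + 1))

/-! ### Embedded quarters -/

/-- The tiles with addresses `u` and `v` are distinct and share an edge. -/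
def Adjacent (u v : List (Fin 5)) : Prop :=
  tile u ≠ tile v ∧ ∃ i j, edge u i = edge v j

/-- The first quarter is embedded in the second one. -/
def Embedded (p q : Address) : Prop := quarter p ⊆ quarter q

/-- The first quarter is strictly embedded in the second one. -/
def StrictlyEmbedded (p q : Address) : Prop := quarter p ⊆ interior (quarter q)

/-- The first quarter is embedded in one step in the second one: their heads share an edge. -/
def OneStep (p q : Address) : Prop := Adjacent p.1 q.1 ∧ Embedded p q

/-- A sequence of quarters each of which is embedded in one step in the next one. -/
def Stepwise (F : ℕ → Address) : Prop := ∀ k, OneStep (F k) (F (k + 1))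

/-- There are no two consecutive one-step embeddings, neither of them strict, whose composition is
a strict embedding. -/
def NoAlternation (F : ℕ → Address) : Prop :=
  ∀ k, ¬ ((OneStep (F k) (F (k + 1)) ∧ ¬ StrictlyEmbedded (F k) (F (k + 1))) ∧
    (OneStep (F (k + 1)) (F (k + 2)) ∧ ¬ StrictlyEmbedded (F (k + 1)) (F (k + 2))) ∧
    StrictlyEmbedded (F k) (F (k + 2)))

/-! ### Sequences that define ends -/

/-- `F` is a stepwise sequence of embedded quarters with no alternation whose vertices converge to
the end `α`. -/
def QuartersDefineEnd (F : ℕ → Address) (α : Circle) : Prop :=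
  Stepwise F ∧ NoAlternation F ∧
    Filter.Tendsto (fun k => vertex (F k)) Filter.atTop (nhds (α : ℂ))

/-- The sequence `L` of lines of the pentagrid defines the end `α`: no line of the sequence passes
through `α`, and the half-planes `H k` delimited by the lines which touch `α` are decreasing and
constitute a basis of neighbourhoods of `α` (a neighbourhood of `α` being a set that contains
a half-plane touching `α`). -/
def LinesDefineEnd (L : ℕ → Address) (α : Circle) : Prop :=
  ∃ H : ℕ → Set ℂ,
    (∀ k, IsHalfPlaneOf (gridLine (L k)) (H k) ∧ Touches (H k) α) ∧
    (∀ k, H (k + 1) ⊆ H k) ∧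
    (∀ U, Touches U α → ∃ k, H k ⊆ U)

/-! ### Algorithms -/

/-- The program `c` computes the sequence `s` of addresses: on input `k` it halts and returns the
code of `s k`. -/
def Computes (c : Nat.Partrec.Code) (s : ℕ → Address) : Prop :=
  ∀ k, Encodable.encode (s k) ∈ c.eval k

/-- The partial function `D`, applied to two programs that compute sequences which define ends in
the sense of `Defines`, halts and tells whether these two ends are equal. Nothing is required of
`D` on other arguments. -/
def DecidesEquality (Defines : (ℕ → Address) → Circle → Prop)
    (D : Nat.Partrec.Code × Nat.Partrec.Code →. Bool) : Prop :=
  ∀ (c d : Nat.Partrec.Code) (s t : ℕ → Address) (α β : Circle),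
    Computes c s → Computes d t → Defines s α → Defines t β →
      ∃ r ∈ D (c, d), (r = true ↔ α = β)

/-- The program number `n` halts on the input `n`. -/
def Halts (n : ℕ) : Prop :=
  ((Denumerable.ofNat Nat.Partrec.Code n).eval n).Dom

end

end Pentagrid

namespace Pentagrid

noncomputable section

/-! Half-planes are handled as vectors of Minkowski space: a reflection of the disc acts on them
linearly, and `vform` changes only by a positive factor. Hence every inclusion becomes a sign of a
linear combination of side vectors.

A walk leaves the head of its quarter through one of the two sides at the vertex, chosen by a bit,
and takes as new vertex the one opposite to the side crossed. Everything rests on one positivity: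
two non-adjacent sides of a tile have ultraparallel lines, and the sum of their vectors is positive
on the closed disc (`vform_motion_side_add_pos`). Reflection in side `j` adds `(1 + √5)` times the
vector of `j` to that of `j + 2` or `j + 3`; so the form of either opposite side of the new tile
exceeds `√5` times the form of the side crossed (`vform_crossing`). Consequently every embedding of
a walk is strict, which leaves no room for an alternation, and the lines crossed are nested. Their
first parameters at least double at each step (`heightBounds_walk`), so the half-planes beyond them
shrink to a single end, `walkEnd`, for any sequence of bits.

Let machine `n` drive the walk, the bit being `true` only when the machine is first seen to halt.
Without halting the walk is the constant one; with halting it turns once, and the half-planes behind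
the two walks separate (`walkEnd_ne`). Since these walks are computable uniformly in `n`, an
equality test for ends, applied to walk `n` and to the walk of a fixed non-halting machine, would
decide the halting problem (`not_decidesEquality`). -/

/-! ### Half-planes as vectors of Minkowski space -/

/-- `form` as a function of the pair of its parameters. -/
def vform (u : ℝ × ℂ) (z : ℂ) : ℝ := form u.1 u.2 z

/-- The Lorentzian inner product on the space of parameters. -/
def lorentz (u v : ℝ × ℂ) : ℝ := u.2.re * v.2.re + u.2.im * v.2.im - u.1 * v.1

/-- The parameters of the half-plane `baseHalfPlane i`. -/
def sideVec (i : Fin 5) : ℝ × ℂ := (1, sideCentre i)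

/-- The Lorentzian reflection with respect to `sideVec i`. -/
def lorentzReflection (i : Fin 5) : (ℝ × ℂ) →ₗ[ℝ] (ℝ × ℂ) where
  toFun u := u - (2 * lorentz u (sideVec i) / √5) • sideVec i
  map_add' u v := by
    ext <;> simp [lorentz, sideVec] <;> ring
  map_smul' c u := by
    ext <;> simp [lorentz, sideVec] <;> ring

/-- The linear map that describes the action of `motion w` on half-planes. -/
def lorentzMotion : List (Fin 5) → (ℝ × ℂ) →ₗ[ℝ] (ℝ × ℂ)
  | [] => LinearMap.id
  | i :: w => lorentzReflection i ∘ₗ lorentzMotion w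

/-- The reflection in a side of a moved tile is a conjugate of a base reflection, so the last letter
acts first. Crossing a side thus reduces to a computation on the base tile. -/
lemma lorentzMotion_append (w : List (Fin 5)) (j : Fin 5) (u : ℝ × ℂ) :
    lorentzMotion (w ++ [j]) u = lorentzMotion w (lorentzReflection j u) := by
  induction w with
  | nil => rfl
  | cons i w ih => simp [lorentzMotion, ih]

lemma motion_append (w : List (Fin 5)) (j : Fin 5) :
    motion (w ++ [j]) = motion w ∘ reflection j := by
  induction w with
  | nil => rfl
  | cons i w ih => simp [motion, ih, Function.comp_assoc]

lemma vform_eq (u : ℝ × ℂ) (z : ℂ) :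
    vform u z = u.1 * (1 + (z.re ^ 2 + z.im ^ 2)) - 2 * (u.2.re * z.re + u.2.im * z.im) := by
  rw [vform, form, Complex.sq_norm, Complex.normSq_apply, Complex.mul_re, Complex.conj_re,
    Complex.conj_im]
  ring

lemma vform_add (u v : ℝ × ℂ) (z : ℂ) : vform (u + v) z = vform u z + vform v z := by
  simp [vform_eq]; ring

lemma vform_smul (c : ℝ) (u : ℝ × ℂ) (z : ℂ) : vform (c • u) z = c * vform u z := by
  simp [vform_eq]; ring

lemma vform_neg (u : ℝ × ℂ) (z : ℂ) : vform (-u) z = -vform u z := by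
  simp [vform_eq]; ring

lemma continuous_vform (u : ℝ × ℂ) : Continuous (vform u) := by
  unfold vform form
  fun_prop

/-! ### The sides of the base tile -/

/-- The rotation of the base tile. -/
def rot : ℂ := Complex.exp ((2 * Real.pi / 5 : ℝ) * Complex.I)

lemma rot_pow_five : rot ^ 5 = 1 := by
  rw [rot, ← Complex.exp_nat_mul, ← Complex.exp_two_pi_mul_I]
  congr 1
  push_cast
  ring

lemma sideCentre_eq (i : Fin 5) :
    sideCentre i = (Real.sqrt (1 + Real.sqrt 5) : ℂ) * rot ^ (i : ℕ) := by
  rw [sideCentre, rot, ← Complex.exp_nat_mul]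
  congr 2
  push_cast
  ring

lemma rot_pow_fin_add (i j : Fin 5) : rot ^ ((i + j : Fin 5) : ℕ) = rot ^ (i : ℕ) * rot ^ (j : ℕ) := by
  rw [Fin.val_add, ← pow_add]
  conv_rhs => rw [← Nat.div_add_mod ((i : ℕ) + j) 5, pow_add, pow_mul, rot_pow_five, one_pow, one_mul]

lemma norm_rot : ‖rot‖ = 1 := Complex.norm_exp_ofReal_mul_I _

lemma sqrt_five_sq : √5 * √5 = (5 : ℝ) := Real.mul_self_sqrt (by norm_num)

lemma two_lt_sqrt_five : (2 : ℝ) < √5 := Real.lt_sqrt_of_sq_lt (by norm_num)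

lemma sqrt_five_lt_three : √5 < (3 : ℝ) := by
  rw [Real.sqrt_lt' (by norm_num)]; norm_num

lemma rot_re : rot.re = (√5 - 1) / 4 := by
  rw [rot, Complex.exp_ofReal_mul_I_re, show 2 * Real.pi / 5 = 2 * (Real.pi / 5) by ring,
    Real.cos_two_mul, Real.cos_pi_div_five]
  nlinarith [sqrt_five_sq]

lemma rot_sq_re : (rot ^ 2).re = -(√5 + 1) / 4 := by
  have h : rot.re * rot.re + rot.im * rot.im = 1 := by
    rw [← Complex.normSq_apply, ← Complex.sq_norm, norm_rot, one_pow]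
  rw [sq, Complex.mul_re]
  have := rot_re
  rw [show rot.im * rot.im = 1 - rot.re * rot.re by linarith, this]
  nlinarith [sqrt_five_sq]

lemma normSq_sideCentre (i : Fin 5) :
    (sideCentre i).re ^ 2 + (sideCentre i).im ^ 2 = 1 + √5 := by
  have h : ‖sideCentre i‖ ^ 2 = 1 + √5 := by
    rw [sideCentre_eq, norm_mul, norm_pow, norm_rot, one_pow, mul_one, Complex.norm_real,
      Real.norm_eq_abs, sq_abs, Real.sq_sqrt (by positivity)]
  rw [← h, Complex.sq_norm, Complex.normSq_apply]
  ring

lemma lorentz_sideVec_self (i : Fin 5) : lorentz (sideVec i) (sideVec i) = √5 := by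
  have := normSq_sideCentre i
  simp only [lorentz, sideVec]
  linarith

lemma lorentz_comm (u v : ℝ × ℂ) : lorentz u v = lorentz v u := by
  simp only [lorentz]; ring

lemma lorentz_sideVec_add (i j : Fin 5) :
    lorentz (sideVec i) (sideVec (i + j)) = (1 + √5) * (rot ^ (j : ℕ)).re - 1 := by
  have h1 : sideCentre (i + j) = sideCentre i * rot ^ (j : ℕ) := by
    rw [sideCentre_eq, sideCentre_eq, rot_pow_fin_add, mul_assoc]
  have := normSq_sideCentre i
  simp only [lorentz, sideVec, h1, Complex.mul_re, Complex.mul_im]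
  rw [← this]
  ring

lemma lorentz_sideVec_add_one (i : Fin 5) : lorentz (sideVec i) (sideVec (i + 1)) = 0 := by
  rw [lorentz_sideVec_add]
  simp only [Fin.val_one, pow_one, rot_re]
  nlinarith [sqrt_five_sq]

lemma lorentz_sideVec_add_two (i : Fin 5) :
    lorentz (sideVec i) (sideVec (i + 2)) = -(5 + √5) / 2 := by
  rw [lorentz_sideVec_add]
  simp only [Fin.val_two, rot_sq_re]
  nlinarith [sqrt_five_sq]

lemma lorentzReflection_apply (i : Fin 5) (u : ℝ × ℂ) :
    lorentzReflection i u = u - (2 * lorentz u (sideVec i) / √5) • sideVec i := rfl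

lemma lorentzReflection_sideVec_self (i : Fin 5) :
    lorentzReflection i (sideVec i) = -sideVec i := by
  have : √5 ≠ 0 := by positivity
  rw [lorentzReflection_apply, lorentz_sideVec_self, mul_div_assoc, div_self this, mul_one,
    two_smul]
  abel

lemma lorentzReflection_add_one (i : Fin 5) :
    lorentzReflection i (sideVec (i + 1)) = sideVec (i + 1) := by
  rw [lorentzReflection_apply, lorentz_comm, lorentz_sideVec_add_one]
  simp

lemma lorentzReflection_add_four (i : Fin 5) :
    lorentzReflection i (sideVec (i + 4)) = sideVec (i + 4) := by
  have h := lorentz_sideVec_add_one (i + 4)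
  rw [show i + 4 + 1 = i by clear h; revert i; decide] at h
  rw [lorentzReflection_apply, h]
  simp

lemma neg_two_mul_div_sqrt_five : 2 * (-(5 + √5) / 2) / √5 = -(1 + √5) := by
  have : √5 ≠ 0 := by positivity
  field_simp
  nlinarith [sqrt_five_sq]

lemma lorentzReflection_add_two (i : Fin 5) :
    lorentzReflection i (sideVec (i + 2)) = sideVec (i + 2) + (1 + √5) • sideVec i := by
  rw [lorentzReflection_apply, lorentz_comm, lorentz_sideVec_add_two, neg_two_mul_div_sqrt_five,
    neg_smul, sub_neg_eq_add]

lemma lorentzReflection_add_three (i : Fin 5) :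
    lorentzReflection i (sideVec (i + 3)) = sideVec (i + 3) + (1 + √5) • sideVec i := by
  have h := lorentz_sideVec_add_two (i + 3)
  rw [show i + 3 + 2 = i by clear h; revert i; decide] at h
  rw [lorentzReflection_apply, h, neg_two_mul_div_sqrt_five, neg_smul, sub_neg_eq_add]

lemma lorentz_lorentzReflection (i : Fin 5) (u : ℝ × ℂ) :
    lorentz (lorentzReflection i u) (lorentzReflection i u) = lorentz u u := by
  have h5 : √5 ≠ 0 := by positivity
  have h := lorentz_sideVec_self i
  set n := sideVec i
  have key : ∀ c : ℝ, lorentz (u - c • n) (u - c • n)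
      = lorentz u u - 2 * c * lorentz u n + c ^ 2 * lorentz n n := by
    intro c
    simp [lorentz]
    ring
  rw [lorentzReflection_apply, key, h]
  field_simp
  ring

lemma lorentz_lorentzMotion (w : List (Fin 5)) (u : ℝ × ℂ) :
    lorentz (lorentzMotion w u) (lorentzMotion w u) = lorentz u u := by
  induction w with
  | nil => rfl
  | cons i w ih => rw [← ih]; exact lorentz_lorentzReflection _ _

/-! ### Reflections and half-planes -/

lemma reflection_involutive (i : Fin 5) : Function.Involutive (reflection i) :=
  EuclideanGeometry.inversion_involutive _ (by positivity)

lemma motion_injective (w : List (Fin 5)) : Function.Injective (motion w) := by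
  induction w with
  | nil => exact Function.injective_id
  | cons i w ih => exact (reflection_involutive i).injective.comp ih

lemma sq_re_add_sq_im_le_one {z : ℂ} (hz : ‖z‖ ≤ 1) : z.re ^ 2 + z.im ^ 2 ≤ 1 := by
  have : ‖z‖ ^ 2 ≤ 1 := pow_le_one₀ (norm_nonneg _) hz
  rw [Complex.sq_norm, Complex.normSq_apply] at this
  linarith

lemma normSq_sub_sideCentre_pos (i : Fin 5) {z : ℂ} (hz : ‖z‖ ≤ 1) :
    0 < Complex.normSq (z - sideCentre i) := by
  rw [Complex.normSq_pos, sub_ne_zero]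
  rintro rfl
  have := sq_re_add_sq_im_le_one hz
  rw [normSq_sideCentre] at this
  have : 0 < √5 := by positivity
  linarith

lemma reflection_eq (i : Fin 5) (z : ℂ) :
    reflection i z = ((√5 / Complex.normSq (z - sideCentre i) : ℝ) : ℂ) * (z - sideCentre i)
      + sideCentre i := by
  rw [reflection, EuclideanGeometry.inversion, div_pow, Real.sq_sqrt (by positivity),
    dist_eq_norm, Complex.sq_norm]
  simp

/-- The factor is that of the inversion of squared radius `√5`. It is positive up to the unit
circle, so signs are preserved at ends as well. -/
lemma vform_reflection (i : Fin 5) {z : ℂ} (hz : ‖z‖ ≤ 1) (u : ℝ × ℂ) :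
    vform u (reflection i z)
      = √5 / Complex.normSq (z - sideCentre i) * vform (lorentzReflection i u) z := by
  have h0 : √5 ≠ 0 := by positivity
  have hd := (normSq_sub_sideCentre_pos i hz).ne'
  have hc := normSq_sideCentre i
  have hN : Complex.normSq (z - sideCentre i)
      = (z.re - (sideCentre i).re) ^ 2 + (z.im - (sideCentre i).im) ^ 2 := by
    rw [Complex.normSq_apply]; simp; ring
  rw [reflection_eq, lorentzReflection_apply, vform_eq, vform_eq]
  generalize Complex.normSq (z - sideCentre i) = N at *
  simp only [lorentz, sideVec, Complex.add_re, Complex.add_im, Complex.re_ofReal_mul,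
    Complex.im_ofReal_mul, Complex.sub_re, Complex.sub_im, Prod.fst_sub, Prod.snd_sub,
    Prod.smul_fst, Prod.smul_snd, smul_eq_mul, Complex.real_smul]
  generalize (sideCentre i).re = p at *
  generalize (sideCentre i).im = q at *
  generalize z.re = x at *
  generalize z.im = y at *
  generalize u.2.re = r at *
  generalize u.2.im = t at *
  generalize u.1 = a at *
  generalize √5 = s at *
  obtain rfl : s = p ^ 2 + q ^ 2 - 1 := by linarith
  field_simp
  subst hN
  ring

lemma one_sub_reflection (i : Fin 5) {z : ℂ} (hz : ‖z‖ ≤ 1) :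
    1 - ‖reflection i z‖ ^ 2
      = √5 / Complex.normSq (z - sideCentre i) * (1 - ‖z‖ ^ 2) := by
  have hd := (normSq_sub_sideCentre_pos i hz).ne'
  have hc := normSq_sideCentre i
  have hN : Complex.normSq (z - sideCentre i)
      = (z.re - (sideCentre i).re) ^ 2 + (z.im - (sideCentre i).im) ^ 2 := by
    rw [Complex.normSq_apply]; simp; ring
  rw [reflection_eq, Complex.sq_norm, Complex.sq_norm, Complex.normSq_apply, Complex.normSq_apply z]
  generalize Complex.normSq (z - sideCentre i) = N at *
  simp only [Complex.add_re, Complex.add_im, Complex.re_ofReal_mul,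
    Complex.im_ofReal_mul, Complex.sub_re, Complex.sub_im]
  generalize (sideCentre i).re = p at *
  generalize (sideCentre i).im = q at *
  generalize z.re = x at *
  generalize z.im = y at *
  generalize √5 = s at *
  obtain rfl : s = p ^ 2 + q ^ 2 - 1 := by linarith
  field_simp
  subst hN
  ring

lemma norm_reflection_le (i : Fin 5) {z : ℂ} (hz : ‖z‖ ≤ 1) : ‖reflection i z‖ ≤ 1 := by
  have h := one_sub_reflection i hz
  have hd := normSq_sub_sideCentre_pos i hz
  have : 0 ≤ 1 - ‖z‖ ^ 2 := by nlinarith [norm_nonneg z]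
  have : 0 ≤ 1 - ‖reflection i z‖ ^ 2 := by rw [h]; positivity
  nlinarith [norm_nonneg (reflection i z)]

lemma norm_reflection_lt (i : Fin 5) {z : ℂ} (hz : ‖z‖ < 1) : ‖reflection i z‖ < 1 := by
  have h := one_sub_reflection i hz.le
  have hd := normSq_sub_sideCentre_pos i hz.le
  have : 0 < 1 - ‖z‖ ^ 2 := by nlinarith [norm_nonneg z]
  have : 0 < 1 - ‖reflection i z‖ ^ 2 := by rw [h]; positivity
  nlinarith [norm_nonneg (reflection i z)]

/-- A half-plane given by the vector of its parameters. -/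
def vecHalfPlane (u : ℝ × ℂ) : Set ℂ := {z | ‖z‖ < 1 ∧ 0 ≤ vform u z}

/-- A hyperbolic line given by the vector of its parameters. -/
def vecLine (u : ℝ × ℂ) : Set ℂ := {z | ‖z‖ < 1 ∧ vform u z = 0}

lemma reflection_preimage (i : Fin 5) (s : Set ℂ) : reflection i '' s = reflection i ⁻¹' s :=
  congrFun (Set.image_eq_preimage_of_inverse (reflection_involutive i) (reflection_involutive i)) s

lemma norm_reflection_lt_iff (i : Fin 5) {z : ℂ} : ‖reflection i z‖ < 1 ↔ ‖z‖ < 1 :=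
  ⟨fun h => by simpa [reflection_involutive i z] using norm_reflection_lt i h,
    norm_reflection_lt i⟩

lemma reflection_image_vecHalfPlane (i : Fin 5) (u : ℝ × ℂ) :
    reflection i '' vecHalfPlane u = vecHalfPlane (lorentzReflection i u) := by
  rw [reflection_preimage]
  ext z
  simp only [vecHalfPlane, Set.mem_preimage, Set.mem_ofPred_eq, norm_reflection_lt_iff]
  refine and_congr_right fun hz => ?_
  have hd := normSq_sub_sideCentre_pos i hz.le
  rw [vform_reflection i hz.le, mul_nonneg_iff_of_pos_left (by positivity)]

lemma reflection_image_vecLine (i : Fin 5) (u : ℝ × ℂ) :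
    reflection i '' vecLine u = vecLine (lorentzReflection i u) := by
  rw [reflection_preimage]
  ext z
  simp only [vecLine, Set.mem_preimage, Set.mem_ofPred_eq, norm_reflection_lt_iff]
  refine and_congr_right fun hz => ?_
  have hd := normSq_sub_sideCentre_pos i hz.le
  rw [vform_reflection i hz.le, mul_eq_zero, or_iff_right (by positivity)]

lemma motion_image_vecHalfPlane (w : List (Fin 5)) (u : ℝ × ℂ) :
    motion w '' vecHalfPlane u = vecHalfPlane (lorentzMotion w u) := by
  induction w with
  | nil => exact Set.image_id _
  | cons i w ih =>
    rw [motion, Set.image_comp, ih, reflection_image_vecHalfPlane]; rfl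

lemma motion_image_vecLine (w : List (Fin 5)) (u : ℝ × ℂ) :
    motion w '' vecLine u = vecLine (lorentzMotion w u) := by
  induction w with
  | nil => exact Set.image_id _
  | cons i w ih =>
    rw [motion, Set.image_comp, ih, reflection_image_vecLine]; rfl

lemma gridLine_eq (p : Address) : gridLine p = vecLine (lorentzMotion p.1 (sideVec p.2)) := by
  rw [← motion_image_vecLine]; rfl

lemma quarter_eq (p : Address) : quarter p =
    vecHalfPlane (lorentzMotion p.1 (sideVec p.2)) ∩
      vecHalfPlane (lorentzMotion p.1 (sideVec (p.2 + 1))) := by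
  rw [quarter, Set.image_inter (motion_injective _), ← motion_image_vecHalfPlane,
    ← motion_image_vecHalfPlane]
  rfl

/-! ### Positivity on the closed disc -/

lemma vform_lorentzMotion_pos {u : ℝ × ℂ} (hu : ∀ z : ℂ, ‖z‖ ≤ 1 → 0 < vform u z)
    (w : List (Fin 5)) : ∀ z : ℂ, ‖z‖ ≤ 1 → 0 < vform (lorentzMotion w u) z := by
  induction w with
  | nil => exact hu
  | cons i w ih =>
    intro z hz
    have hd := normSq_sub_sideCentre_pos i hz
    have h := ih _ (norm_reflection_le i hz)
    rw [vform_reflection i hz] at h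
    exact pos_of_mul_pos_right h (by positivity)

/-- The sum is timelike: its Lorentzian square is `2√5 - (5 + √5) < 0`. Its first parameter being 2,
the form is a positive definite quadratic expression in `z`. -/
lemma vform_side_add_pos (i : Fin 5) (z : ℂ) :
    0 < vform (sideVec i + sideVec (i + 2)) z := by
  have h1 := normSq_sideCentre i
  have h2 := normSq_sideCentre (i + 2)
  have h3 := lorentz_sideVec_add_two i
  have h5 := sqrt_five_lt_three
  simp only [lorentz, sideVec] at h3
  rw [vform_eq]
  simp only [sideVec, Prod.fst_add, Prod.snd_add, Complex.add_re, Complex.add_im]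
  set p := (sideCentre i).re + (sideCentre (i + 2)).re with hp
  set q := (sideCentre i).im + (sideCentre (i + 2)).im with hq
  -- The left side equals `√5 - 1`.
  have hpq : p ^ 2 + q ^ 2 < 4 := by
    rw [hp, hq]; nlinarith
  nlinarith [sq_nonneg (p - 2 * z.re), sq_nonneg (q - 2 * z.im), sq_nonneg (1 - z.re),
    sq_nonneg z.re, sq_nonneg z.im]

lemma vform_motion_side_add_pos (w : List (Fin 5)) (i : Fin 5) {z : ℂ} (hz : ‖z‖ ≤ 1) :
    0 < vform (lorentzMotion w (sideVec i)) z + vform (lorentzMotion w (sideVec (i + 2))) z := by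
  rw [← vform_add, ← map_add]
  exact vform_lorentzMotion_pos (fun z _ => vform_side_add_pos i z) w z hz

/-! ### Vertices -/

lemma vform_sideVec_baseVertex (i : Fin 5) :
    vform (sideVec i) (baseVertex i) = 0 ∧ vform (sideVec (i + 1)) (baseVertex i) = 0 := by
  set s := √(1 + √5 / 2) with hs
  set t := √(√5 / 2) with ht
  have hss : s ^ 2 = 1 + √5 / 2 := Real.sq_sqrt (by positivity)
  have htt : t ^ 2 = √5 / 2 := Real.sq_sqrt (by positivity)
  set η : ℂ := Complex.exp ((Real.pi / 5 : ℝ) * Complex.I) with hη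
  have hηη : rot = η * η := by
    rw [rot, hη, ← Complex.exp_add]; congr 1; push_cast; ring
  have hV : baseVertex i = rot ^ (i : ℕ) * (((s - t : ℝ) : ℂ) * η) := by
    rw [baseVertex, rot, hη, ← Complex.exp_nat_mul, mul_left_comm, ← Complex.exp_add]
    congr 2
    push_cast
    ring
  have hηre : η.re = (1 + √5) / 4 := by
    rw [hη, Complex.exp_ofReal_mul_I_re, Real.cos_pi_div_five]
  have hηn : ‖η‖ = 1 := Complex.norm_exp_ofReal_mul_I _
  have hn : ‖baseVertex i‖ ^ 2 = (s - t) ^ 2 := by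
    rw [hV, norm_mul, norm_mul, norm_pow, norm_rot, hηn, Complex.norm_real, Real.norm_eq_abs,
      one_pow, one_mul, mul_one, sq_abs]
  -- `s` is the projection of either centre on the ray through the vertex, which makes the angle
  -- `π/5` with both.
  have hC : √(1 + √5) * ((1 + √5) / 4) = s := by
    rw [hs, eq_comm, Real.sqrt_eq_iff_mul_self_eq (by positivity) (by positivity)]
    have : √(1 + √5) * √(1 + √5) = 1 + √5 := Real.mul_self_sqrt (by positivity)
    rw [mul_mul_mul_comm, this]
    nlinarith [sqrt_five_sq]
  have hrr : (starRingEnd ℂ) (rot ^ (i : ℕ)) * rot ^ (i : ℕ) = 1 := by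
    rw [Complex.conj_mul', norm_pow, norm_rot]; simp
  have hee : (starRingEnd ℂ) η * η = 1 := by
    rw [Complex.conj_mul', hηn]; simp
  -- The equation to solve is `1 + (s - t)² = 2 s (s - t)`, that is, `s² - t² = 1`.
  have fin : ∀ b : ℂ, ((starRingEnd ℂ) b * baseVertex i).re = s * (s - t) →
      form 1 b (baseVertex i) = 0 := by
    intro b hb
    rw [form, hn, hb]
    nlinarith
  refine ⟨fin _ ?_, fin _ ?_⟩
  · have : (starRingEnd ℂ) (sideCentre i) * baseVertex i
        = ((√(1 + √5) * (s - t) : ℝ) : ℂ) * η := by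
      rw [sideCentre_eq, hV, map_mul, Complex.conj_ofReal]
      push_cast
      linear_combination (√(1 + √5) : ℂ) * ((s : ℂ) - t) * η * hrr
    rw [sideVec, this, Complex.re_ofReal_mul, hηre, ← hC]
    ring
  · have : (starRingEnd ℂ) (sideCentre (i + 1)) * baseVertex i
        = ((√(1 + √5) * (s - t) : ℝ) : ℂ) * (starRingEnd ℂ) η := by
      rw [sideCentre_eq, rot_pow_fin_add, hV, map_mul, map_mul, Complex.conj_ofReal]
      simp only [Fin.val_one, pow_one]
      conv_lhs => rw [show (starRingEnd ℂ) rot = (starRingEnd ℂ) η * (starRingEnd ℂ) η by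
        rw [hηη, map_mul]]
      push_cast
      linear_combination (√(1 + √5) : ℂ) * ((s : ℂ) - t) * (starRingEnd ℂ) η *
        ((starRingEnd ℂ) η * η * hrr + hee)
    rw [sideVec, this, Complex.re_ofReal_mul, Complex.conj_re, hηre, ← hC]
    ring

lemma norm_baseVertex_lt (i : Fin 5) : ‖baseVertex i‖ < 1 := by
  have h2 := two_lt_sqrt_five
  rw [baseVertex, norm_mul, Complex.norm_exp_ofReal_mul_I, mul_one, Complex.norm_real,
    Real.norm_eq_abs, abs_lt]
  have h : √(1 + √5 / 2) ^ 2 = 1 + √5 / 2 := Real.sq_sqrt (by positivity)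
  have h' : √(√5 / 2) ^ 2 = √5 / 2 := Real.sq_sqrt (by positivity)
  have : 0 < √(1 + √5 / 2) := by positivity
  have : 0 < √(√5 / 2) := by positivity
  constructor <;> nlinarith

lemma vertex_mem (p : Address) :
    vertex p ∈ vecLine (lorentzMotion p.1 (sideVec p.2)) ∧
      vertex p ∈ vecLine (lorentzMotion p.1 (sideVec (p.2 + 1))) := by
  obtain ⟨h1, h2⟩ := vform_sideVec_baseVertex p.2
  rw [← motion_image_vecLine, ← motion_image_vecLine]
  exact ⟨⟨_, ⟨norm_baseVertex_lt _, h1⟩, rfl⟩, ⟨_, ⟨norm_baseVertex_lt _, h2⟩, rfl⟩⟩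

/-! ### Adjacent tiles -/

/-- The side lies on the circle of inversion, which the reflection fixes pointwise. -/
lemma edge_append (w : List (Fin 5)) (j : Fin 5) : edge (w ++ [j]) j = edge w j := by
  rw [edge, edge, motion_append, Set.image_comp]
  congr 1
  refine (Set.image_congr fun z hz => ?_).trans (Set.image_id _)
  have hz0 : vform (sideVec j) z = 0 := hz.2.2
  refine EuclideanGeometry.inversion_of_mem_sphere ?_
  rw [Metric.mem_sphere, dist_eq_norm, ← sq_eq_sq₀ (norm_nonneg _) (Real.sqrt_nonneg _),
    Real.sq_sqrt (Real.sqrt_nonneg _), Complex.sq_norm, Complex.normSq_apply]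
  have := normSq_sideCentre j
  rw [vform_eq] at hz0
  simp only [sideVec] at hz0
  simp only [Complex.sub_re, Complex.sub_im]
  linarith

lemma zero_mem_baseTile : (0 : ℂ) ∈ baseTile :=
  Set.mem_iInter.2 fun _ => ⟨by simp, by simp [form]⟩

lemma tile_append_ne (w : List (Fin 5)) (j : Fin 5) : tile w ≠ tile (w ++ [j]) := by
  intro h
  rw [tile, tile, motion_append, Set.image_comp] at h
  have h0 : (0 : ℂ) ∈ reflection j '' baseTile :=
    (motion_injective w).image_injective h ▸ zero_mem_baseTile
  have hsub : reflection j '' baseTile ⊆ vecHalfPlane (lorentzReflection j (sideVec j)) :=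
    reflection_image_vecHalfPlane j _ ▸ Set.image_mono (Set.iInter_subset _ j)
  have := (hsub h0).2
  rw [lorentzReflection_sideVec_self, vform_eq] at this
  simp [sideVec] at this
  linarith

lemma adjacent_append (w : List (Fin 5)) (j : Fin 5) : Adjacent w (w ++ [j]) :=
  ⟨tile_append_ne w j, j, j, (edge_append w j).symm⟩

/-! ### Crossing a side -/

lemma add_two_add_one (j : Fin 5) : j + 2 + 1 = j + 3 := by revert j; decide

lemma lorentzMotion_append_add_two (w : List (Fin 5)) (j : Fin 5) :
    lorentzMotion (w ++ [j]) (sideVec (j + 2)) =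
      lorentzMotion w (sideVec (j + 2)) + (1 + √5) • lorentzMotion w (sideVec j) := by
  rw [lorentzMotion_append, lorentzReflection_add_two, map_add, map_smul]

lemma lorentzMotion_append_add_three (w : List (Fin 5)) (j : Fin 5) :
    lorentzMotion (w ++ [j]) (sideVec (j + 3)) =
      lorentzMotion w (sideVec (j + 3)) + (1 + √5) • lorentzMotion w (sideVec j) := by
  rw [lorentzMotion_append, lorentzReflection_add_three, map_add, map_smul]

/-- The new form is that of side `m` of the old tile plus `1 + √5` times that of side `j`. One copy
of the latter makes the sum over two non-adjacent sides positive; `√5` copies remain. -/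
lemma vform_crossing (w : List (Fin 5)) {j m : Fin 5} (hm : m = j + 2 ∨ m = j + 3) {z : ℂ}
    (hz : ‖z‖ ≤ 1) :
    √5 * vform (lorentzMotion w (sideVec j)) z
      < vform (lorentzMotion (w ++ [j]) (sideVec m)) z := by
  rcases hm with rfl | rfl
  · rw [lorentzMotion_append_add_two, vform_add, vform_smul]
    linarith [vform_motion_side_add_pos w j hz]
  · have := vform_motion_side_add_pos w (j + 3) hz
    rw [show j + 3 + 2 = j by clear this; revert j; decide] at this
    rw [lorentzMotion_append_add_three, vform_add, vform_smul]
    linarith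

lemma subset_interior_vecHalfPlane (u : ℝ × ℂ) :
    {z : ℂ | ‖z‖ < 1 ∧ 0 < vform u z} ⊆ interior (vecHalfPlane u) :=
  interior_maximal (fun _ hz => ⟨hz.1, hz.2.le⟩)
    ((isOpen_lt continuous_norm continuous_const).inter
      (isOpen_lt continuous_const (continuous_vform u)))

/-- Only the half-plane of the crossed side is used: it already lies in the interior of both new
half-planes. -/
lemma strictlyEmbedded_crossing {w : List (Fin 5)} {v j : Fin 5} (hj : j = v ∨ j = v + 1) :
    StrictlyEmbedded (w, v) (w ++ [j], j + 2) := by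
  intro z hz
  rw [quarter_eq] at hz ⊢
  have hz1 : z ∈ vecHalfPlane (lorentzMotion w (sideVec j)) := by
    rcases hj with rfl | rfl
    exacts [hz.1, hz.2]
  have key : ∀ m, m = j + 2 ∨ m = j + 3 →
      z ∈ interior (vecHalfPlane (lorentzMotion (w ++ [j]) (sideVec m))) := by
    intro m hm
    refine subset_interior_vecHalfPlane _ ⟨hz1.1, ?_⟩
    exact lt_of_le_of_lt (mul_nonneg (Real.sqrt_nonneg _) hz1.2) (vform_crossing w hm hz1.1.le)
  rw [interior_inter]
  exact ⟨key _ (Or.inl rfl), key _ (Or.inr (add_two_add_one j))⟩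

/-! ### Walks through the pentagrid -/

/-- The side through which a walk leaves the head of a quarter with vertex number `v`. -/
def exitSide (v : Fin 5) (b : Bool) : Fin 5 := bif b then v + 1 else v

lemma exitSide_eq (v : Fin 5) (b : Bool) : exitSide v b = v ∨ exitSide v b = v + 1 := by
  cases b
  exacts [Or.inl rfl, Or.inr rfl]

/-- The quarter that follows the quarter `p` when its head is left through the side chosen by
`b`. -/
def crossing (p : Address) (b : Bool) : Address :=
  (p.1 ++ [exitSide p.2 b], exitSide p.2 b + 2)

/-- The sequence of quarters determined by a sequence of choices. -/
def walk (b : ℕ → Bool) : ℕ → Address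
  | 0 => ([], 0)
  | k + 1 => crossing (walk b k) (b k)

/-- The sequence of lines crossed by a walk. -/
def exits (b : ℕ → Bool) (k : ℕ) : Address :=
  ((walk b k).1, exitSide (walk b k).2 (b k))

lemma strictlyEmbedded_walk (b : ℕ → Bool) (k : ℕ) :
    StrictlyEmbedded (walk b k) (walk b (k + 1)) :=
  strictlyEmbedded_crossing (exitSide_eq _ _)

lemma stepwise_walk (b : ℕ → Bool) : Stepwise (walk b) := fun k =>
  ⟨adjacent_append _ _, (strictlyEmbedded_walk b k).trans interior_subset⟩

lemma noAlternation_walk (b : ℕ → Bool) : NoAlternation (walk b) :=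
  fun k h => h.1.2 (strictlyEmbedded_walk b k)

/-- The parameters of the line number `k` crossed by a walk. -/
def exitVec (b : ℕ → Bool) (k : ℕ) : ℝ × ℂ :=
  lorentzMotion (exits b k).1 (sideVec (exits b k).2)

lemma gridLine_exits (b : ℕ → Bool) (k : ℕ) : gridLine (exits b k) = vecLine (exitVec b k) :=
  gridLine_eq _

lemma vertex_walk_mem (b : ℕ → Bool) (k : ℕ) : vertex (walk b k) ∈ vecLine (exitVec b k) := by
  rw [exitVec]
  simp only [exits]
  rcases exitSide_eq (walk b k).2 (b k) with h | h <;> rw [h]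
  exacts [(vertex_mem _).1, (vertex_mem _).2]

lemma lorentz_exitVec (b : ℕ → Bool) (k : ℕ) :
    lorentz (exitVec b k) (exitVec b k) = √5 := by
  rw [exitVec, lorentz_lorentzMotion, lorentz_sideVec_self]

lemma exits_succ (b : ℕ → Bool) (k : ℕ) :
    (exits b (k + 1)).1 = (exits b k).1 ++ [(exits b k).2] ∧
    ((exits b (k + 1)).2 = (exits b k).2 + 2 ∨ (exits b (k + 1)).2 = (exits b k).2 + 3) := by
  refine ⟨rfl, ?_⟩
  rw [← add_two_add_one]
  exact exitSide_eq _ _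

lemma vform_exitVec_succ (b : ℕ → Bool) (k : ℕ) {z : ℂ} (hz : ‖z‖ ≤ 1) :
    √5 * vform (exitVec b k) z < vform (exitVec b (k + 1)) z := by
  obtain ⟨h1, h2⟩ := exits_succ b k
  rw [exitVec, exitVec, h1]
  exact vform_crossing _ h2 hz

lemma vform_exitVec_neg (b : ℕ → Bool) (k : ℕ) {z : ℂ} (hz : ‖z‖ ≤ 1)
    (h : vform (exitVec b (k + 1)) z ≤ 0) : vform (exitVec b k) z < 0 := by
  have := (vform_exitVec_succ b k hz).trans_le h
  exact neg_of_mul_neg_right this (Real.sqrt_nonneg _)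

/-! ### Growth of the parameters -/

/-- The first parameter of the line that supports side `i` of the tile with address `w`. -/
def height (w : List (Fin 5)) (i : Fin 5) : ℝ := (lorentzMotion w (sideVec i)).1

lemma height_nil (i : Fin 5) : height [] i = 1 := rfl

lemma height_append_self (w : List (Fin 5)) (j : Fin 5) :
    height (w ++ [j]) j = -height w j := by
  simp [height, lorentzMotion_append, lorentzReflection_sideVec_self]

lemma height_append_add_one (w : List (Fin 5)) (j : Fin 5) :
    height (w ++ [j]) (j + 1) = height w (j + 1) := by
  simp [height, lorentzMotion_append, lorentzReflection_add_one]

lemma height_append_add_four (w : List (Fin 5)) (j : Fin 5) :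
    height (w ++ [j]) (j + 4) = height w (j + 4) := by
  simp [height, lorentzMotion_append, lorentzReflection_add_four]

lemma height_append_add_two (w : List (Fin 5)) (j : Fin 5) :
    height (w ++ [j]) (j + 2) = height w (j + 2) + (1 + √5) * height w j := by
  simp [height, lorentzMotion_append_add_two]

lemma height_append_add_three (w : List (Fin 5)) (j : Fin 5) :
    height (w ++ [j]) (j + 3) = height w (j + 3) + (1 + √5) * height w j := by
  simp [height, lorentzMotion_append_add_three]

/-- The heights of the sides of a tile that a walk enters through side `v + 3`, bounded in terms of
a lower bound `c` of those of the sides `v` and `v + 1`. -/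
structure HeightBounds (c : ℝ) (p : Address) : Prop where
  left : c ≤ height p.1 p.2
  right : c ≤ height p.1 (p.2 + 1)
  next : 0 < height p.1 (p.2 + 2)
  prev : 0 < height p.1 (p.2 + 4)
  entry_left : -height p.1 p.2 ≤ 2 * height p.1 (p.2 + 3)
  entry_right : -height p.1 (p.2 + 1) ≤ 2 * height p.1 (p.2 + 3)

/-- Only the entry side may have negative height. It contributes to the height of one of the two new
sides at the vertex, where by `entry_left` or `entry_right` it costs at most half the height `x` of
the side crossed. Since `(1 + √5) x > 3 x`, more than `2 x` is left. The side crossed becomes the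
new entry side, with height `-x`, which restores the entry bounds. -/
lemma HeightBounds.crossing {c : ℝ} (hc : 0 < c) {p : Address} (h : HeightBounds c p) (b : Bool) :
    HeightBounds (2 * c) (crossing p b) := by
  obtain ⟨w, v⟩ := p
  obtain ⟨h1, h2, h3, h4, h5, h6⟩ := h
  have h25 := two_lt_sqrt_five
  have key : ∀ x : ℝ, c ≤ x → 3 * x < (1 + √5) * x := fun x hx => by
    have : 0 < x := hc.trans_le hx
    nlinarith
  simp only at h1 h2 h3 h4 h5 h6
  have e (j : Fin 5) : j + 2 + 1 = j + 3 ∧ j + 2 + 2 = j + 4 ∧ j + 2 + 4 = j + 1 ∧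
      j + 2 + 3 = j := by revert j; decide
  have e' : v + 1 + 2 = v + 3 ∧ v + 1 + 3 = v + 4 ∧ v + 1 + 4 = v ∧ v + 1 + 1 = v + 2 := by
    clear * -; revert v; decide
  cases b
  · have k := key _ h1
    refine ⟨?_, ?_, ?_, ?_, ?_, ?_⟩ <;>
      simp only [Pentagrid.crossing, exitSide, cond_false, e, height_append_self,
        height_append_add_one, height_append_add_two, height_append_add_three,
        height_append_add_four] <;>
      linarith
  · have k := key _ h2
    refine ⟨?_, ?_, ?_, ?_, ?_, ?_⟩ <;>
      simp only [Pentagrid.crossing, exitSide, cond_true, e, height_append_self,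
        height_append_add_one, height_append_add_two, height_append_add_three,
        height_append_add_four] <;>
      simp only [e'] <;>
      linarith

lemma heightBounds_walk (b : ℕ → Bool) (k : ℕ) : HeightBounds (2 ^ k) (walk b k) := by
  induction k with
  | zero => constructor <;> simp [walk, height_nil] <;> norm_num
  | succ k ih => rw [pow_succ']; exact ih.crossing (by positivity) _

lemma two_pow_le_exitVec (b : ℕ → Bool) (k : ℕ) : 2 ^ k ≤ (exitVec b k).1 := by
  have h := heightBounds_walk b k
  change _ ≤ height (walk b k).1 (exitSide _ _)
  rcases exitSide_eq (walk b k).2 (b k) with h' | h' <;> rw [h']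
  exacts [h.left, h.right]

lemma exitVec_pos (b : ℕ → Bool) (k : ℕ) : 0 < (exitVec b k).1 :=
  (by positivity : (0 : ℝ) < 2 ^ k).trans_le (two_pow_le_exitVec b k)

lemma normSq_exitVec (b : ℕ → Bool) (k : ℕ) :
    ‖(exitVec b k).2‖ ^ 2 = (exitVec b k).1 ^ 2 + √5 := by
  have := lorentz_exitVec b k
  rw [lorentz] at this
  rw [Complex.sq_norm, Complex.normSq_apply]
  linarith

lemma exitVec_lt_norm (b : ℕ → Bool) (k : ℕ) : (exitVec b k).1 < ‖(exitVec b k).2‖ := by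
  have h := normSq_exitVec b k
  have : 0 < √5 := by positivity
  exact lt_of_pow_lt_pow_left₀ 2 (norm_nonneg _) (by linarith)

/-! ### The end of a walk -/

/-- The closed arcs beyond the crossed lines are nested and compact, so Cantor's intersection
theorem applies. -/
lemma exists_end (b : ℕ → Bool) : ∃ α : Circle, ∀ k, vform (exitVec b k) α < 0 := by
  let C : ℕ → Set ℂ := fun k => Metric.sphere 0 1 ∩ {z | vform (exitVec b k) z ≤ 0}
  have hclosed : ∀ k, IsClosed {z | vform (exitVec b k) z ≤ 0} := fun k =>
    isClosed_le (continuous_vform _) continuous_const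
  have hne : (⋂ k, C k).Nonempty := by
    refine IsCompact.nonempty_iInter_of_sequence_nonempty_isCompact_isClosed C ?_ ?_
      ((isCompact_sphere 0 1).inter_right (hclosed 0))
      (fun k => Metric.isClosed_sphere.inter (hclosed k))
    · exact fun k z hz => ⟨hz.1, (vform_exitVec_neg b k (mem_sphere_zero_iff_norm.1 hz.1).le hz.2).le⟩
    · intro k
      have hlt := exitVec_lt_norm b k
      have hpos : 0 < ‖(exitVec b k).2‖ := (exitVec_pos b k).trans hlt
      -- The midpoint `b / |b|` of the arc, where the form takes the value `2 (a - |b|) < 0`.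
      refine ⟨((‖(exitVec b k).2‖⁻¹ : ℝ) : ℂ) * (exitVec b k).2, ?_, ?_⟩
      · rw [mem_sphere_zero_iff_norm, norm_mul, Complex.norm_real, norm_inv, norm_norm,
          inv_mul_cancel₀ hpos.ne']
      · have h : ‖(exitVec b k).2‖ ^ 2 = (exitVec b k).2.re ^ 2 + (exitVec b k).2.im ^ 2 := by
          rw [Complex.sq_norm, Complex.normSq_apply]; ring
        rw [Set.mem_ofPred_eq, vform_eq, Complex.re_ofReal_mul, Complex.im_ofReal_mul]
        have e1 : (‖(exitVec b k).2‖⁻¹ * (exitVec b k).2.re) ^ 2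
            + (‖(exitVec b k).2‖⁻¹ * (exitVec b k).2.im) ^ 2 = 1 := by
          rw [mul_pow, mul_pow, ← mul_add, ← h]; field_simp
        have e2 : (exitVec b k).2.re * (‖(exitVec b k).2‖⁻¹ * (exitVec b k).2.re)
            + (exitVec b k).2.im * (‖(exitVec b k).2‖⁻¹ * (exitVec b k).2.im)
            = ‖(exitVec b k).2‖ := by
          rw [show (exitVec b k).2.re * (‖(exitVec b k).2‖⁻¹ * (exitVec b k).2.re)
            + (exitVec b k).2.im * (‖(exitVec b k).2‖⁻¹ * (exitVec b k).2.im)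
            = ‖(exitVec b k).2‖⁻¹ * ((exitVec b k).2.re ^ 2 + (exitVec b k).2.im ^ 2) by ring,
            ← h]
          field_simp
        rw [e1, e2]
        linarith
  obtain ⟨z, hz⟩ := hne
  rw [Set.mem_iInter] at hz
  have hz1 := mem_sphere_zero_iff_norm.1 (hz 0).1
  -- The weak inequality at index `k + 1` gives the strict one at `k`.
  exact ⟨⟨z, mem_sphere_zero_iff_norm.2 hz1⟩, fun k => vform_exitVec_neg b k hz1.le (hz (k + 1)).2⟩

/-- The end to which a walk tends. -/
def walkEnd (b : ℕ → Bool) : Circle := (exists_end b).choose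

lemma vform_walkEnd (b : ℕ → Bool) (k : ℕ) : vform (exitVec b k) (walkEnd b) < 0 :=
  (exists_end b).choose_spec k

/-- A half-plane on the far side of a line with parameters `(a, b)`, `0 < a`, is contained in the
disc with centre `b / a`. -/
lemma norm_sub_centre_le {u : ℝ × ℂ} {c : ℝ} (hu : 0 < u.1) (h : ‖u.2‖ ^ 2 = u.1 ^ 2 + c ^ 2)
    (hc : 0 ≤ c) {z : ℂ} (hz : vform u z ≤ 0) : ‖z - ((u.1⁻¹ : ℝ) : ℂ) * u.2‖ ≤ c / u.1 := by
  refine le_of_sq_le_sq ?_ (by positivity)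
  rw [Complex.sq_norm, Complex.normSq_apply] at h ⊢
  simp only [Complex.sub_re, Complex.sub_im, Complex.re_ofReal_mul, Complex.im_ofReal_mul]
  rw [vform_eq] at hz
  rw [div_pow, le_div_iff₀ (by positivity)]
  have : ((z.re - u.1⁻¹ * u.2.re) * (z.re - u.1⁻¹ * u.2.re)
      + (z.im - u.1⁻¹ * u.2.im) * (z.im - u.1⁻¹ * u.2.im)) * u.1 ^ 2
      = u.1 * (u.1 * (z.re ^ 2 + z.im ^ 2) - 2 * (u.2.re * z.re + u.2.im * z.im))
        + (u.2.re * u.2.re + u.2.im * u.2.im) := by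
    field_simp; ring
  rw [this]
  nlinarith

/-- Both points lie in one Euclidean disc of radius `√√5 / a`, with `√√5 ≤ 2` and `a ≥ 2 ^ k`. -/
lemma dist_walkEnd_le (b : ℕ → Bool) (k : ℕ) {z : ℂ} (hz : vform (exitVec b k) z ≤ 0) :
    dist z (walkEnd b) ≤ 4 * (1 / 2) ^ k := by
  have hpos := exitVec_pos b k
  have h : ‖(exitVec b k).2‖ ^ 2 = (exitVec b k).1 ^ 2 + √√5 ^ 2 := by
    rw [Real.sq_sqrt (by positivity), normSq_exitVec]
  have h1 := norm_sub_centre_le hpos h (Real.sqrt_nonneg _) hz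
  have h2 := norm_sub_centre_le hpos h (Real.sqrt_nonneg _) (vform_walkEnd b k).le
  have h5 : √√5 ≤ 2 := by
    rw [Real.sqrt_le_left (by norm_num)]
    linarith [sqrt_five_lt_three]
  have h3 : √√5 / (exitVec b k).1 ≤ 2 * (1 / 2) ^ k := by
    rw [one_div, inv_pow, ← div_eq_mul_inv]
    exact div_le_div₀ (by norm_num) h5 (by positivity) (two_pow_le_exitVec b k)
  rw [← dist_eq_norm] at h1 h2
  linarith [dist_triangle_right z (walkEnd b : ℂ) (((exitVec b k).1⁻¹ : ℝ) * (exitVec b k).2)]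

lemma tendsto_four_mul_pow :
    Filter.Tendsto (fun k : ℕ => 4 * (1 / 2 : ℝ) ^ k) Filter.atTop (nhds 0) := by
  simpa using (tendsto_pow_atTop_nhds_zero_of_lt_one (r := (1 / 2 : ℝ)) (by norm_num)
    (by norm_num)).const_mul 4

theorem quartersDefineEnd_walk (b : ℕ → Bool) : QuartersDefineEnd (walk b) (walkEnd b) :=
  ⟨stepwise_walk b, noAlternation_walk b, tendsto_iff_dist_tendsto_zero.2 <|
    squeeze_zero (fun _ => dist_nonneg)
      (fun k => dist_walkEnd_le b k (vertex_walk_mem b k).2.le) tendsto_four_mul_pow⟩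

theorem linesDefineEnd_exits (b : ℕ → Bool) : LinesDefineEnd (exits b) (walkEnd b) := by
  have habs : ∀ k, |(-exitVec b k).1| < ‖(-exitVec b k).2‖ := fun k => by
    rw [Prod.fst_neg, Prod.snd_neg, abs_neg, norm_neg, abs_of_pos (exitVec_pos b k)]
    exact exitVec_lt_norm b k
  -- The vectors `exitVec b k` are negative at the end, so the half-planes that touch it carry the
  -- opposite sign.
  refine ⟨fun k => vecHalfPlane (-exitVec b k), fun k => ⟨⟨_, _, habs k, ?_, rfl⟩,
    _, _, habs k, rfl, ?_⟩, ?_, ?_⟩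
  · rw [gridLine_exits]
    change vecLine _ = vecLine (-exitVec b k)
    ext z
    simp only [vecLine, Set.mem_ofPred_eq, vform_neg, neg_eq_zero]
  · change 0 < vform (-exitVec b k) _
    rw [vform_neg]
    linarith [vform_walkEnd b k]
  · rintro k z ⟨hz, h⟩
    rw [vform_neg] at h
    refine ⟨hz, ?_⟩
    rw [vform_neg]
    linarith [vform_exitVec_neg b k hz.le (by linarith)]
  · rintro U ⟨a, c, -, rfl, h⟩
    have hopen : IsOpen {z | 0 < vform (a, c) z} :=
      isOpen_lt continuous_const (continuous_vform _)
    obtain ⟨ε, hε, hsub⟩ := Metric.isOpen_iff.1 hopen _ h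
    obtain ⟨k, hk⟩ := (tendsto_four_mul_pow.eventually_lt_const hε).exists
    refine ⟨k, fun z hz => ⟨hz.1, le_of_lt (hsub ?_)⟩⟩
    have hz2 := hz.2
    rw [vform_neg] at hz2
    exact (dist_walkEnd_le b k (by linarith)).trans_lt hk

/-! ### Walks that diverge -/

lemma walk_congr {b b' : ℕ → Bool} {t : ℕ} (h : ∀ k < t, b k = b' k) : walk b t = walk b' t := by
  induction t with
  | zero => rfl
  | succ t ih =>
    rw [walk, walk, ih fun k hk => h k (hk.trans t.lt_succ_self), h t t.lt_succ_self]

/-- One walk passes beyond side `v`; the other crosses `v + 1` and then side `v + 3` of the new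
tile. Reflection in `v + 1` fixes the line of the adjacent side `v`, so both lines support
non-adjacent sides of the new tile and no end lies beyond both. The bit `false` at `t + 1` matters:
a second `true` would lead through side `v + 4`, adjacent to `v`. -/
theorem walkEnd_ne {b b' : ℕ → Bool} {t : ℕ} (h : ∀ k < t, b k = b' k) (hb : b t = false)
    (hb' : b' t = true) (hb'' : b' (t + 1) = false) : walkEnd b ≠ walkEnd b' := by
  intro he
  have h1 := vform_walkEnd b t
  have h2 := vform_walkEnd b' (t + 1)
  rw [he] at h1
  obtain ⟨hw, -⟩ := exits_succ b' t
  have hs : (exits b' (t + 1)).2 = (walk b t).2 + 3 := by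
    simp only [exits, walk, crossing, hb', hb'', exitSide, cond_true, cond_false]
    rw [walk_congr h]
    generalize (walk b' t).2 = v
    revert v; decide
  rw [exitVec, hw, hs] at h2
  simp only [exits, hb', hb, ← walk_congr h, exitSide, cond_true, exitVec, cond_false] at h1 h2
  set w := (walk b t).1
  set v := (walk b t).2
  have hp := vform_motion_side_add_pos (w ++ [v + 1]) (v + 3)
    (z := walkEnd b') (Circle.norm_coe _).le
  rw [show v + 3 + 2 = v + 1 + 4 by generalize v = x; revert x; decide,
    lorentzMotion_append w _ (sideVec (v + 1 + 4)), lorentzReflection_add_four,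
    show v + 1 + 4 = v by generalize v = x; revert x; decide] at hp
  linarith

open Nat.Partrec (Code)

/-! ### Walks driven by machines -/

/-- The machine number `n` halts on the input `n` within `k` units of time. -/
def haltsWithin (n k : ℕ) : Bool :=
  (Code.evaln k (Denumerable.ofNat Code n) n).isSome

/-- The machine number `n`, applied to the input `n`, is seen to halt exactly at time `k`. -/
def haltsAt (n k : ℕ) : Bool := haltsWithin n (k + 1) && !haltsWithin n k

lemma halts_iff {n : ℕ} : Halts n ↔ ∃ k, haltsWithin n k = true := by
  simp only [Halts, Part.dom_iff_mem, haltsWithin, Option.isSome_iff_exists, Code.evaln_complete]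
  exact exists_comm

lemma not_haltsWithin_zero (n : ℕ) : ¬ haltsWithin n 0 = true := by
  simp [haltsWithin, Code.evaln]

lemma haltsAt_eq_false_of_not_halts {n : ℕ} (h : ¬ Halts n) (k : ℕ) : haltsAt n k = false := by
  have : haltsWithin n (k + 1) = false := by
    rw [← Bool.not_eq_true]
    exact fun hk => h (halts_iff.2 ⟨_, hk⟩)
  rw [haltsAt, this, Bool.false_and]

lemma exists_haltsAt {n : ℕ} (h : Halts n) :
    ∃ t, (∀ k < t, haltsAt n k = false) ∧ haltsAt n t = true ∧ haltsAt n (t + 1) = false := by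
  classical
  have hex := halts_iff.1 h
  -- Nothing halts within time 0, so the first successful time bound is a successor `t + 1`, and the
  -- turn occurs at index `t`.
  obtain ⟨t, ht⟩ : ∃ t, Nat.find hex = t + 1 :=
    Nat.exists_eq_succ_of_ne_zero fun h0 => not_haltsWithin_zero n (h0 ▸ Nat.find_spec hex)
  have hlt : ∀ k ≤ t, haltsWithin n k = false := fun k hk =>
    Bool.not_eq_true _ ▸ Nat.find_min hex (by omega)
  have hge : haltsWithin n (t + 1) = true := ht ▸ Nat.find_spec hex
  refine ⟨t, fun k hk => ?_, ?_, ?_⟩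
  · rw [haltsAt, hlt (k + 1) hk, Bool.false_and]
  · rw [haltsAt, hge, hlt t le_rfl]; rfl
  · rw [haltsAt, hge, Bool.not_true, Bool.and_false]

lemma primrec_haltsWithin : Primrec₂ haltsWithin :=
  Primrec.option_isSome.comp <| Code.primrec_evaln.comp <|
    (Primrec.snd.pair ((Primrec.ofNat Code).comp Primrec.fst)).pair Primrec.fst

lemma primrec_haltsAt : Primrec₂ haltsAt :=
  Primrec.and.comp
    (primrec_haltsWithin.comp Primrec.fst (Primrec.succ.comp Primrec.snd))
    (Primrec.not.comp (primrec_haltsWithin.comp Primrec.fst Primrec.snd))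

lemma primrec_exitSide : Primrec₂ exitSide := Primrec.dom_finite _

lemma primrec_crossing : Primrec₂ crossing := by
  have hside : Primrec fun q : Address × Bool => exitSide q.1.2 q.2 :=
    primrec_exitSide.comp (Primrec.snd.comp Primrec.fst) Primrec.snd
  exact (Primrec.list_append.comp (Primrec.fst.comp Primrec.fst)
    (Primrec.list_cons.comp hside (Primrec.const []))).pair
    ((Primrec.dom_finite fun j : Fin 5 => j + 2).comp hside)

/-- The quarters of the walk driven by the machine number `n`. -/
def machineWalk (n k : ℕ) : Address := walk (haltsAt n) k

/-- The lines crossed by the walk driven by the machine number `n`. -/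
def machineExits (n k : ℕ) : Address := exits (haltsAt n) k

lemma primrec_machineWalk : Primrec₂ machineWalk := by
  refine (Primrec.nat_rec (f := fun _ : ℕ => (([], 0) : Address))
    (g := fun n q => crossing q.2 (haltsAt n q.1)) (Primrec.const _) ?_).of_eq ?_
  · exact primrec_crossing.comp (Primrec.snd.comp Primrec.snd)
      (primrec_haltsAt.comp Primrec.fst (Primrec.fst.comp Primrec.snd))
  · intro n k
    induction k with
    | zero => rfl
    | succ k ih => simp only [machineWalk, walk] at ih ⊢; rw [ih]

lemma primrec_machineExits : Primrec₂ machineExits :=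
  (Primrec.fst.comp primrec_machineWalk).pair
    (primrec_exitSide.comp (Primrec.snd.comp primrec_machineWalk) primrec_haltsAt)

/-- The end of the walk that never meets a halting machine. -/
def straightEnd : Circle := walkEnd fun _ => false

lemma walkEnd_eq_straightEnd {n : ℕ} (h : ¬ Halts n) : walkEnd (haltsAt n) = straightEnd := by
  rw [straightEnd, funext (haltsAt_eq_false_of_not_halts h)]

lemma walkEnd_ne_straightEnd {n : ℕ} (h : Halts n) : walkEnd (haltsAt n) ≠ straightEnd := by
  obtain ⟨t, h1, h2, h3⟩ := exists_haltsAt h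
  exact (walkEnd_ne (fun k hk => (h1 k hk).symm) rfl h2 h3).symm

/-! ### Undecidability -/

/-- The halting of a machine on its own number is undecidable. -/
lemma not_partrec_of_decides_not_halts {f : ℕ →. Bool} (hf : Partrec f)
    (h : ∀ n, ∃ r ∈ f n, (r = true ↔ ¬ Halts n)) : False := by
  -- Diagonal program: it halts on `n` exactly when `f` answers that machine `n` does not halt on
  -- `n`; it is then run on its own code.
  have hg : Partrec fun n => (f n).bind fun r => bif r then Part.some 0 else (Part.none : Part ℕ) :=
    hf.bind (Partrec.cond Computable.snd (Computable.const 0).partrec Partrec.none).to₂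
  obtain ⟨c, hc⟩ := Code.exists_code.1 (Partrec.nat_iff.1 hg)
  obtain ⟨r, hr, hrn⟩ := h (Encodable.encode c)
  have key : Halts (Encodable.encode c) ↔ r = true := by
    have hv : c.eval (Encodable.encode c) = bif r then Part.some 0 else Part.none := by
      rw [hc]
      exact (congrArg (Part.bind · _) (Part.eq_some_iff.2 hr)).trans (Part.bind_some _ _)
    rw [Halts, Denumerable.ofNat_encode, hv]
    cases r <;> simp
  rw [← key] at hrn
  exact iff_not_self hrn

/-- The s-m-n theorem, in the form of `Code.curry`: one program for the double sequence is
specialised computably in `n`. -/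
lemma exists_computes {s : ℕ → ℕ → Address} (hs : Computable₂ s) :
    ∃ c : ℕ → Code, Computable c ∧ ∀ n, Computes (c n) (s n) := by
  have h : Computable fun m : ℕ => Encodable.encode (s m.unpair.1 m.unpair.2) :=
    Computable.encode.comp (hs.comp (Computable.fst.comp Computable.unpair)
      (Computable.snd.comp Computable.unpair))
  obtain ⟨c, hc⟩ := Code.exists_code.1 (Partrec.nat_iff.1 h)
  refine ⟨fun n => Code.curry c n,
    (Code.primrec₂_curry.comp (Primrec.const c) Primrec.id).to_comp, fun n k => ?_⟩
  rw [Code.eval_curry, hc]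
  simp

/-- All pairs submitted to `D` define ends, so its promise always applies, and its answers decide
non-halting. -/
lemma not_decidesEquality {Defines : (ℕ → Address) → Circle → Prop} {s : ℕ → ℕ → Address}
    (hs : Computable₂ s) {e : ℕ → Circle} {α₀ : Circle} (hdef : ∀ n, Defines (s n) (e n))
    (hne : ∀ n, ¬ Halts n → e n = α₀) (hh : ∀ n, Halts n → e n ≠ α₀) :
    ¬ ∃ D : Code × Code →. Bool, Partrec D ∧ DecidesEquality Defines D := by
  rintro ⟨D, hD, hdec⟩
  obtain ⟨c, hc, hcs⟩ := exists_computes hs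
  -- If every machine halted on its own number, the constant answer `false` would decide
  -- non-halting.
  obtain ⟨n₀, hn₀⟩ : ∃ n, ¬ Halts n := by
    by_contra! hall
    exact not_partrec_of_decides_not_halts (Computable.const false).partrec
      fun n => ⟨false, Part.mem_some _, by simp [hall n]⟩
  refine not_partrec_of_decides_not_halts (f := fun n => D (c n, c n₀))
    (hD.comp (hc.pair (Computable.const _))) fun n => ?_
  obtain ⟨r, hr, hiff⟩ := hdec _ _ _ _ _ _ (hcs n) (hcs n₀) (hdef n) (hdef n₀)
  refine ⟨r, hr, hiff.trans ?_⟩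
  rw [hne n₀ hn₀]
  exact ⟨fun he hn => hh n hn he, hne n⟩

end

end Pentagrid

theorem theorem2 :
    (¬ ∃ D : Nat.Partrec.Code × Nat.Partrec.Code →. Bool,
        Partrec D ∧ Pentagrid.DecidesEquality Pentagrid.LinesDefineEnd D) ∧
    (¬ ∃ D : Nat.Partrec.Code × Nat.Partrec.Code →. Bool,
        Partrec D ∧ Pentagrid.DecidesEquality Pentagrid.QuartersDefineEnd D) ∧
    (∃ (F L : ℕ → ℕ → Pentagrid.Address) (e : ℕ → Circle) (α₀ : Circle),
        Computable₂ F ∧ Computable₂ L ∧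
        ∀ n, Pentagrid.QuartersDefineEnd (F n) (e n) ∧ Pentagrid.LinesDefineEnd (L n) (e n) ∧
          (¬ Pentagrid.Halts n → e n = α₀) ∧ (Pentagrid.Halts n → e n ≠ α₀)) := by
  open Pentagrid in
  have hF : Computable₂ machineWalk := primrec_machineWalk.to_comp
  have hL : Computable₂ machineExits := primrec_machineExits.to_comp
  have hne : ∀ n, ¬ Halts n → walkEnd (haltsAt n) = straightEnd := fun _ => walkEnd_eq_straightEnd
  have hh : ∀ n, Halts n → walkEnd (haltsAt n) ≠ straightEnd := fun _ => walkEnd_ne_straightEnd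
  have hQ (n : ℕ) : QuartersDefineEnd (machineWalk n) (walkEnd (haltsAt n)) :=
    quartersDefineEnd_walk _
  have hLn (n : ℕ) : LinesDefineEnd (machineExits n) (walkEnd (haltsAt n)) :=
    linesDefineEnd_exits _
  exact ⟨not_decidesEquality hL hLn hne hh, not_decidesEquality hF hQ hne hh,
    machineWalk, machineExits, fun n => walkEnd (haltsAt n), straightEnd, hF, hL,
    fun n => ⟨hQ n, hLn n, hne n, hh n⟩⟩
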